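/- **Theorem 3.3.** Let $\mathcal{AX}_{\mathtt{diff}}$ be the theory in many-sorted first-order logic with equality that has three sorts $\mathtt{ARRAY}$, $\mathtt{INDEX}$, $\mathtt{ELEM}$, the function symbols $$rd:\mathtt{ARRAY}\times\mathtt{INDEX}\to\mathtt{ELEM},\qquad wr:\mathtt{ARRAY}\times\mathtt{INDEX}\times\mathtt{ELEM}\to\mathtt{ARRAY},\qquad \mathtt{diff}:\mathtt{ARRAY}\times\mathtt{ARRAY}\to\mathtt{INDEX},$$ no predicate symbol other than equality, and the axioms $$\forall y,i,e.\ rd(wr(y,i,e),i)=e,$$ $$\forall y,i,j,e.\ i\neq j\Rightarrow rd(wr(y,i,e),j)=rd(y,j),$$ $$\forall x,y.\ x\neq y\Rightarrow rd(x,\mathtt{diff}(x,y))\neq rd(y,\mathtt{diff}(x,y)).$$ Formulae may contain free variables of all three sorts and the propositional constant $\bot$. A formula is $\mathcal{AX}_{\mathtt{diff}}$-satisfiable if it is true in some model of $\mathcal{AX}_{\mathtt{diff}}$ under some assignment to its free variables. A formula $\psi$ $\mathcal{AX}_{\mathtt{diff}}$-entails a formula $\theta$ if $\neg(\psi\to\theta)$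 is not $\mathcal{AX}_{\mathtt{diff}}$-satisfiable. Then $\mathcal{AX}_{\mathtt{diff}}$ admits quantifier-free interpolation: for every pair of quantifier-free formulae $\phi,\psi$ over this signature such that $\psi\wedge\phi$ is not $\mathcal{AX}_{\mathtt{diff}}$-satisfiable, there exists a quantifier-free formula $\theta$ over this signature such that 1. $\psi$ $\mathcal{AX}_{\mathtt{diff}}$-entails $\theta$; 2. $\theta\wedge\phi$ is not $\mathcal{AX}_{\mathtt{diff}}$-satisfiable; 3. only variables occurring both in $\psi$ and in $\phi$ occur in $\theta$. (The symbols $rd,wr,\mathtt{diff}$ may all be used in $\theta$.) -/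

import Mathlib

universe u

namespace ArraysDiff

/-! ### Many-sorted first-order logic over the signature of arrays with `diff` -/

/-- The three sorts of the theory of arrays. -/
inductive ArrSort : Type
  | array
  | index
  | elem
  deriving DecidableEq

open ArrSort

/-- Sorted terms over the function symbols `rd : ARRAY × INDEX → ELEM`,
`wr : ARRAY × INDEX × ELEM → ARRAY` and `diff : ARRAY × ARRAY → INDEX`.
For each sort there are countably many individual variables `var s 0, var s 1, …`. -/
inductive Term : ArrSort → Type
  | var (s : ArrSort) (n : ℕ) : Term s
  | rd (a : Term array) (i : Term index) : Term elem
  | wr (a : Term array) (i : Term index) (e : Term elem) : Term array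
  | diff (a b : Term array) : Term index

/-- First-order formulae; equality (between terms of the same sort) is the only predicate.
The other connectives are definable from `falsum` and `imp`. -/
inductive Formula : Type
  | falsum : Formula
  | eq {s : ArrSort} (t t' : Term s) : Formula
  | imp (φ ψ : Formula) : Formula
  | all (s : ArrSort) (n : ℕ) (φ : Formula) : Formula

/-- Negation. -/
def Formula.neg (φ : Formula) : Formula := .imp φ .falsum

/-- Conjunction. -/
def Formula.and (φ ψ : Formula) : Formula := .neg (.imp φ (.neg ψ))

/-- The variables (sort and number) occurring in a term. -/
def Term.vars : {s : ArrSort} → Term s → Finset (ArrSort × ℕ)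
  | _, .var s n => {(s, n)}
  | _, .rd a i => a.vars ∪ i.vars
  | _, .wr a i e => a.vars ∪ i.vars ∪ e.vars
  | _, .diff a b => a.vars ∪ b.vars

/-- The free variables of a formula. In a quantifier-free formula these are all the variables
that occur in it. -/
def Formula.freeVars : Formula → Finset (ArrSort × ℕ)
  | .falsum => ∅
  | .eq t t' => t.vars ∪ t'.vars
  | .imp φ ψ => φ.freeVars ∪ ψ.freeVars
  | .all s n φ => φ.freeVars.erase (s, n)

/-- Quantifier-free formulae. -/
def Formula.QuantifierFree : Formula → Prop
  | .falsum => True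
  | .eq _ _ => True
  | .imp φ ψ => φ.QuantifierFree ∧ ψ.QuantifierFree
  | .all _ _ _ => False

/-- Many-sorted structures for the signature. The interpretation of each sort is non-empty and
that of each function symbol is arbitrary. -/
structure Struc : Type (u + 1) where
  carrier : ArrSort → Type u
  nonempty : ∀ s, Nonempty (carrier s)
  rd : carrier array → carrier index → carrier elem
  wr : carrier array → carrier index → carrier elem → carrier array
  diff : carrier array → carrier array → carrier index

/-- Sort-preserving assignments of the variables in a structure. -/
abbrev Assignment (M : Struc.{u}) : Type u := (s : ArrSort) → ℕ → M.carrier s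

/-- The assignment that agrees with `α`, except that variable `n` of sort `s` has value `x`. -/
def Assignment.update {M : Struc.{u}} (α : Assignment M) (s : ArrSort) (n : ℕ)
    (x : M.carrier s) : Assignment M :=
  Function.update α s (Function.update (α s) n x)

/-- The value of a term under an assignment. -/
def Term.eval (M : Struc.{u}) (α : Assignment M) : {s : ArrSort} → Term s → M.carrier s
  | _, .var s n => α s n
  | _, .rd a i => M.rd (a.eval M α) (i.eval M α)
  | _, .wr a i e => M.wr (a.eval M α) (i.eval M α) (e.eval M α)
  | _, .diff a b => M.diff (a.eval M α) (b.eval M α)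

/-- Truth of a formula in a structure under an assignment. -/
def Formula.Holds (M : Struc.{u}) : Assignment M → Formula → Prop
  | _, .falsum => False
  | α, .eq t t' => t.eval M α = t'.eval M α
  | α, .imp φ ψ => φ.Holds M α → ψ.Holds M α
  | α, .all s n φ => ∀ x : M.carrier s, φ.Holds M (α.update s n x)

/-- Sentences are formulae without free variables. -/
abbrev Sentence : Type := {φ : Formula // φ.freeVars = ∅}

/-- A theory over the signature is a set of sentences, its axioms. -/
abbrev Theory : Type := Set Sentence

/-- `M` is a model of `T`: all the axioms of `T` are true in `M`. -/
def IsModel (T : Theory) (M : Struc.{u}) : Prop :=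
  ∀ σ ∈ T, ∀ α : Assignment M, σ.1.Holds M α

/-- `φ` is `T`-satisfiable: it is true in some model of `T` under some assignment. -/
def Satisfiable (T : Theory) (φ : Formula) : Prop :=
  ∃ M : Struc.{u}, IsModel T M ∧ ∃ α : Assignment M, φ.Holds M α

/-- `φ` is `T`-valid: its negation is not `T`-satisfiable. -/
def Valid (T : Theory) (φ : Formula) : Prop := ¬ Satisfiable.{u} T φ.neg

/-- `φ` `T`-entails `ψ`. -/
def Entails (T : Theory) (φ ψ : Formula) : Prop := Valid.{u} T (.imp φ ψ)

/-- `θ` is a quantifier-free interpolant of `ψ` and `φ` modulo `T`. -/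
def IsInterpolant (T : Theory) (ψ φ θ : Formula) : Prop :=
  θ.QuantifierFree ∧ Entails.{u} T ψ θ ∧ ¬ Satisfiable.{u} T (θ.and φ) ∧
    θ.freeVars ⊆ ψ.freeVars ∩ φ.freeVars

/-- `T` admits quantifier-free interpolation. -/
def AdmitsQuantifierFreeInterpolation (T : Theory) : Prop :=
  ∀ φ ψ : Formula, φ.QuantifierFree → ψ.QuantifierFree →
    ¬ Satisfiable.{u} T (ψ.and φ) → ∃ θ : Formula, IsInterpolant.{u} T ψ φ θ

/-! ### The theory of arrays with `diff` -/

/-- `∀ y i e, rd (wr (y, i, e), i) = e`. -/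
def readOverWriteSame : Sentence :=
  ⟨.all array 0 <| .all index 0 <| .all elem 0 <|
    .eq (.rd (.wr (.var array 0) (.var index 0) (.var elem 0)) (.var index 0)) (.var elem 0),
   by decide⟩

/-- `∀ y i j e, i ≠ j → rd (wr (y, i, e), j) = rd (y, j)`. -/
def readOverWriteOther : Sentence :=
  ⟨.all array 0 <| .all index 0 <| .all index 1 <| .all elem 0 <|
    .imp (.neg (.eq (.var index 0) (.var index 1)))
      (.eq (.rd (.wr (.var array 0) (.var index 0) (.var elem 0)) (.var index 1))
        (.rd (.var array 0) (.var index 1))),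
   by decide⟩

/-- `∀ x y, x ≠ y → rd (x, diff (x, y)) ≠ rd (y, diff (x, y))`. -/
def diffExtensionality : Sentence :=
  ⟨.all array 0 <| .all array 1 <|
    .imp (.neg (.eq (.var array 0) (.var array 1)))
      (.neg (.eq (.rd (.var array 0) (.diff (.var array 0) (.var array 1)))
        (.rd (.var array 1) (.diff (.var array 0) (.var array 1))))),
   by decide⟩

/-- The theory of arrays with `diff`. -/
def AXdiff : Theory := {readOverWriteSame, readOverWriteOther, diffExtensionality}

end ArraysDiff

namespace ArraysDiff

open ArrSort Filter

/-! ### Models of the theory of arrays with `diff` -/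

/-! If no quantifier-free formula over the shared variables separates the models of `ψ` from those
of `φ`, compactness in ultraproduct form yields models `M` of `ψ` and `N` of `φ` agreeing on all
such formulae (`exists_models_agreeing`). The substructures generated by the shared variables are
then isomorphic, and amalgamating `M` and `N` over them (`exists_amalgam`) gives one model of `ψ ∧
φ`, a contradiction.

For the amalgam, glue the index sets and the element sets, and take all functions between the
results as arrays. An array of `M` must be given values at indices coming only from `N`. If it
differs finitely often from a shared array, it copies that array's values there; these are
unambiguous by `PartialIso.rd_eq_of_finite`, which uses `diff` to reach every difference by shared
writes. One extra index carries markers that keep non-shared arrays of `M` and `N` apart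
(`IsRepresentation.rel_of_eq`). Hence `diff` can be prescribed on both images without conflict. -/

/-- The semantic content of the axioms of `AXdiff`. -/
structure Struc.IsArrayModel (M : Struc.{u}) : Prop where
  rd_wr_same : ∀ y i e, M.rd (M.wr y i e) i = e
  rd_wr_other : ∀ y i j e, i ≠ j → M.rd (M.wr y i e) j = M.rd y j
  rd_diff : ∀ x y, x ≠ y → M.rd x (M.diff x y) ≠ M.rd y (M.diff x y)

theorem isModel_AXdiff_iff (M : Struc.{u}) : IsModel AXdiff M ↔ M.IsArrayModel := by
  constructor
  · intro h
    have ⟨α⟩ : Nonempty (Assignment M) := ⟨fun s _ => (M.nonempty s).some⟩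
    refine ⟨fun y i e => ?_, fun y i j e => ?_, fun x y => ?_⟩
    · simpa [readOverWriteSame, Formula.Holds, Term.eval, Assignment.update] using
        h readOverWriteSame (by simp [AXdiff]) α y i e
    · simpa [readOverWriteOther, Formula.Holds, Formula.neg, Term.eval, Assignment.update] using
        h readOverWriteOther (by simp [AXdiff]) α y i j e
    · simpa [diffExtensionality, Formula.Holds, Formula.neg, Term.eval, Assignment.update] using
        h diffExtensionality (by simp [AXdiff]) α x y
  · rintro ⟨h₁, h₂, h₃⟩ σ hσ α
    simp only [AXdiff, Set.mem_insert_iff, Set.mem_singleton_iff] at hσ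
    rcases hσ with rfl | rfl | rfl
    · intro y i e
      simpa [Formula.Holds, Term.eval, Assignment.update] using h₁ y i e
    · intro y i j e
      simpa [Formula.Holds, Formula.neg, Term.eval, Assignment.update] using h₂ y i j e
    · intro x y
      simpa [Formula.Holds, Formula.neg, Term.eval, Assignment.update] using h₃ x y

theorem Formula.holds_neg {M : Struc.{u}} {α : Assignment M} {φ : Formula} :
    φ.neg.Holds M α ↔ ¬ φ.Holds M α := Iff.rfl

theorem Formula.holds_and {M : Struc.{u}} {α : Assignment M} {φ ψ : Formula} :
    (φ.and ψ).Holds M α ↔ φ.Holds M α ∧ ψ.Holds M α := by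
  simp [Formula.and, Formula.neg, Formula.Holds]

/-! ### Separation by finitely many formulae -/

/-- Two classes of assigned structures of which no two members agree on the finitely many
quantifier-free formulae over `V` in `Δ` are separated by such a formula. -/
theorem exists_separating_formula (V : Finset (ArrSort × ℕ)) (Δ : Finset Formula)
    (P Q : ∀ M : Struc.{u}, Assignment M → Prop)
    (h : ∀ M α N β, P M α → Q N β → ∃ d ∈ Δ, d.QuantifierFree ∧ d.freeVars ⊆ V ∧
      ¬ (d.Holds M α ↔ d.Holds N β)) :
    ∃ θ : Formula, θ.QuantifierFree ∧ θ.freeVars ⊆ V ∧ (∀ M α, P M α → θ.Holds M α) ∧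
      ∀ M α, Q M α → ¬ θ.Holds M α := by
  classical
  induction Δ using Finset.induction_on generalizing P Q with
  | empty =>
    -- With no formulae to disagree on, one of the two classes is empty.
    by_cases hP : ∃ M α, P M α
    · obtain ⟨M, α, hM⟩ := hP
      refine ⟨.neg .falsum, ⟨trivial, trivial⟩, by simp [Formula.neg, Formula.freeVars],
        fun _ _ _ => id, fun N β hN => ?_⟩
      simpa using h M α N β hM hN
    · push Not at hP
      exact ⟨.falsum, trivial, by simp [Formula.freeVars], fun M α hM => (hP M α hM).elim,
        fun _ _ _ => id⟩
  | insert d Δ _ ih =>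
    by_cases hd : d.QuantifierFree ∧ d.freeVars ⊆ V
    -- Split both classes by the truth value of `d`. Within each half `d` distinguishes nothing, so
    -- `Δ` suffices; the separators are joined by "if `d` then `θ` else `χ`".
    · obtain ⟨θ, hθ, hθV, hθP, hθQ⟩ := ih (fun M α => P M α ∧ d.Holds M α)
        (fun M α => Q M α ∧ d.Holds M α) (by
          rintro M α N β ⟨hM, hdM⟩ ⟨hN, hdN⟩
          obtain ⟨e, he, h'⟩ := h M α N β hM hN
          rcases Finset.mem_insert.1 he with rfl | he
          · exact (h'.2.2 (iff_of_true hdM hdN)).elim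
          · exact ⟨e, he, h'⟩)
      obtain ⟨χ, hχ, hχV, hχP, hχQ⟩ := ih (fun M α => P M α ∧ ¬ d.Holds M α)
        (fun M α => Q M α ∧ ¬ d.Holds M α) (by
          rintro M α N β ⟨hM, hdM⟩ ⟨hN, hdN⟩
          obtain ⟨e, he, h'⟩ := h M α N β hM hN
          rcases Finset.mem_insert.1 he with rfl | he
          · exact (h'.2.2 (iff_of_false hdM hdN)).elim
          · exact ⟨e, he, h'⟩)
      refine ⟨(d.imp θ).and (d.neg.imp χ), ?_, ?_, fun M α hM => ?_, fun M α hM => ?_⟩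
      · simp [Formula.and, Formula.neg, Formula.QuantifierFree, hd.1, hθ, hχ]
      · simp [Formula.and, Formula.neg, Formula.freeVars, Finset.union_subset_iff, hd.2, hθV, hχV]
      · rw [Formula.holds_and]
        exact ⟨fun hdM => hθP M α ⟨hM, hdM⟩, fun hdM => hχP M α ⟨hM, hdM⟩⟩
      · rw [Formula.holds_and]
        rintro ⟨h₁, h₂⟩
        by_cases hdM : d.Holds M α
        · exact hθQ M α ⟨hM, hdM⟩ (h₁ hdM)
        · exact hχQ M α ⟨hM, hdM⟩ (h₂ hdM)
    · refine ih P Q fun M α N β hM hN => ?_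
      obtain ⟨e, he, h'⟩ := h M α N β hM hN
      rcases Finset.mem_insert.1 he with rfl | he
      · exact (hd ⟨h'.1, h'.2.1⟩).elim
      · exact ⟨e, he, h'⟩

/-! ### Ultraproducts -/

section Ultraproduct

variable {ι : Type} (U : Ultrafilter ι) (M : ι → Struc.{u})

/-- The ultraproduct of a family of structures. -/
def Struc.ultraproduct : Struc.{u} where
  carrier s := Filter.Product (U : Filter ι) fun i => (M i).carrier s
  nonempty s := ⟨Quotient.mk'' fun i => ((M i).nonempty s).some⟩
  rd := Quotient.map₂ (fun a j i => (M i).rd (a i) (j i)) fun _ _ h _ _ h' => by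
    filter_upwards [h, h'] with i e e'
    rw [e, e']
  wr a j := Quotient.liftOn₂ a j
    (fun a j => Quotient.map (fun e i => (M i).wr (a i) (j i) (e i)) fun _ _ h => by
      filter_upwards [h] with i e
      rw [e])
    fun a j a' j' h h' => by
      funext x
      induction x using Quotient.inductionOn with | _ x
      refine Quotient.sound ?_
      filter_upwards [h, h'] with i e e'
      rw [e, e']
  diff := Quotient.map₂ (fun a b i => (M i).diff (a i) (b i)) fun _ _ h _ _ h' => by
    filter_upwards [h, h'] with i e e'
    rw [e, e']

variable {M}

/-- The element of the ultraproduct represented by a family. -/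
def Struc.ultraMk {s : ArrSort} (x : ∀ i, (M i).carrier s) :
    (Struc.ultraproduct U M).carrier s :=
  Quotient.mk (productSetoid (U : Filter ι) fun i => (M i).carrier s) x

theorem Struc.ultraMk_surjective {s : ArrSort} (x : (Struc.ultraproduct U M).carrier s) :
    ∃ y : ∀ i, (M i).carrier s, Struc.ultraMk U y = x :=
  Quotient.exists_rep x

theorem Struc.ultraMk_eq_iff {s : ArrSort} (x y : ∀ i, (M i).carrier s) :
    Struc.ultraMk U x = Struc.ultraMk U y ↔ ∀ᶠ i in U, x i = y i :=
  Quotient.eq (r := productSetoid (U : Filter ι) fun i => (M i).carrier s)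

theorem Struc.ultraproduct_rd (a : ∀ i, (M i).carrier array) (j : ∀ i, (M i).carrier index) :
    (Struc.ultraproduct U M).rd (Struc.ultraMk U a) (Struc.ultraMk U j) =
      Struc.ultraMk U fun i => (M i).rd (a i) (j i) := rfl

theorem Struc.ultraproduct_wr (a : ∀ i, (M i).carrier array) (j : ∀ i, (M i).carrier index)
    (e : ∀ i, (M i).carrier elem) :
    (Struc.ultraproduct U M).wr (Struc.ultraMk U a) (Struc.ultraMk U j) (Struc.ultraMk U e) =
      Struc.ultraMk U fun i => (M i).wr (a i) (j i) (e i) := rfl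

theorem Struc.ultraproduct_diff (a b : ∀ i, (M i).carrier array) :
    (Struc.ultraproduct U M).diff (Struc.ultraMk U a) (Struc.ultraMk U b) =
      Struc.ultraMk U fun i => (M i).diff (a i) (b i) := rfl

/-- The assignment in the ultraproduct induced by a family of assignments. -/
def Assignment.ultraproduct (α : ∀ i, Assignment (M i)) :
    Assignment (Struc.ultraproduct U M) :=
  fun s n => Struc.ultraMk U fun i => α i s n

theorem Term.eval_ultraproduct (α : ∀ i, Assignment (M i)) {s : ArrSort} (t : Term s) :
    t.eval _ (Assignment.ultraproduct U α) = Struc.ultraMk U fun i => t.eval (M i) (α i) := by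
  induction t with
  | var s n => rfl
  | rd a i iha ihi => rw [Term.eval, iha, ihi]; rfl
  | wr a i e iha ihi ihe => rw [Term.eval, iha, ihi, ihe]; rfl
  | diff a b iha ihb => rw [Term.eval, iha, ihb]; rfl

/-- Łoś's theorem for quantifier-free formulae. -/
theorem Formula.holds_ultraproduct (α : ∀ i, Assignment (M i)) {φ : Formula}
    (hφ : φ.QuantifierFree) :
    φ.Holds _ (Assignment.ultraproduct U α) ↔ ∀ᶠ i in U, φ.Holds (M i) (α i) := by
  induction φ with
  | falsum => simp [Formula.Holds, U.neBot.ne]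
  | eq t t' =>
    simp only [Formula.Holds, Term.eval_ultraproduct, Struc.ultraMk_eq_iff]
  | imp φ ψ ih₁ ih₂ =>
    simp only [Formula.Holds, ih₁ hφ.1, ih₂ hφ.2, Ultrafilter.eventually_imp]
  | all => exact hφ.elim

theorem Struc.IsArrayModel.ultraproduct (h : ∀ i, (M i).IsArrayModel) :
    (Struc.ultraproduct U M).IsArrayModel := by
  refine ⟨fun y i e => ?_, fun y i j e => ?_, fun x y => ?_⟩
  · obtain ⟨y, rfl⟩ := Struc.ultraMk_surjective U y
    obtain ⟨i, rfl⟩ := Struc.ultraMk_surjective U i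
    obtain ⟨e, rfl⟩ := Struc.ultraMk_surjective U e
    rw [Struc.ultraproduct_wr, Struc.ultraproduct_rd, Struc.ultraMk_eq_iff]
    exact .of_forall fun k => (h k).rd_wr_same _ _ _
  · obtain ⟨y, rfl⟩ := Struc.ultraMk_surjective U y
    obtain ⟨i, rfl⟩ := Struc.ultraMk_surjective U i
    obtain ⟨j, rfl⟩ := Struc.ultraMk_surjective U j
    obtain ⟨e, rfl⟩ := Struc.ultraMk_surjective U e
    rw [Struc.ultraproduct_wr, Struc.ultraproduct_rd, Struc.ultraproduct_rd, Ne,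
      Struc.ultraMk_eq_iff, Struc.ultraMk_eq_iff, ← Ultrafilter.eventually_not]
    exact fun hij => hij.mono fun k => (h k).rd_wr_other _ _ _ _
  · obtain ⟨x, rfl⟩ := Struc.ultraMk_surjective U x
    obtain ⟨y, rfl⟩ := Struc.ultraMk_surjective U y
    rw [Struc.ultraproduct_diff, Struc.ultraproduct_rd, Struc.ultraproduct_rd, Ne, Ne,
      Struc.ultraMk_eq_iff, Struc.ultraMk_eq_iff, ← Ultrafilter.eventually_not,
      ← Ultrafilter.eventually_not]
    exact fun hxy => hxy.mono fun k => (h k).rd_diff _ _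

end Ultraproduct

/-- If no quantifier-free formula over `V` separates the models of `ψ` from those of `φ`, some
model of `ψ` and some model of `φ` satisfy the same quantifier-free formulae over `V`. -/
theorem exists_models_agreeing {V : Finset (ArrSort × ℕ)} {ψ φ : Formula}
    (hψ : ψ.QuantifierFree) (hφ : φ.QuantifierFree)
    (h : ¬ ∃ θ : Formula, θ.QuantifierFree ∧ θ.freeVars ⊆ V ∧
      (∀ (M : Struc.{u}) (α : Assignment M), M.IsArrayModel ∧ ψ.Holds M α → θ.Holds M α) ∧
      ∀ (M : Struc.{u}) (α : Assignment M), M.IsArrayModel ∧ φ.Holds M α → ¬ θ.Holds M α) :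
    ∃ (M : Struc.{u}) (α : Assignment M) (N : Struc.{u}) (β : Assignment N),
      M.IsArrayModel ∧ N.IsArrayModel ∧ ψ.Holds M α ∧ φ.Holds N β ∧
      ∀ d : Formula, d.QuantifierFree → d.freeVars ⊆ V → (d.Holds M α ↔ d.Holds N β) := by
  classical
  have key : ∀ Δ : Finset Formula, ∃ (M : Struc.{u}) (α : Assignment M) (N : Struc.{u})
      (β : Assignment N), (M.IsArrayModel ∧ ψ.Holds M α) ∧ (N.IsArrayModel ∧ φ.Holds N β) ∧
      ∀ d ∈ Δ, d.QuantifierFree → d.freeVars ⊆ V → (d.Holds M α ↔ d.Holds N β) := by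
    intro Δ
    by_contra hΔ
    refine h (exists_separating_formula V Δ _ _ fun M α N β hM hN => ?_)
    by_contra hd
    refine hΔ ⟨M, α, N, β, hM, hN, fun d hdΔ hqf hdV => ?_⟩
    by_contra hiff
    exact hd ⟨d, hdΔ, hqf, hdV, hiff⟩
  choose M α N β hM hN hd using key
  -- Refining `atTop` makes every fixed formula belong to almost every `Δ`.
  let U : Ultrafilter (Finset Formula) := Ultrafilter.of atTop
  refine ⟨_, Assignment.ultraproduct U α, _, Assignment.ultraproduct U β,
    Struc.IsArrayModel.ultraproduct U fun Δ => (hM Δ).1,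
    Struc.IsArrayModel.ultraproduct U fun Δ => (hN Δ).1,
    (Formula.holds_ultraproduct U α hψ).2 (.of_forall fun Δ => (hM Δ).2),
    (Formula.holds_ultraproduct U β hφ).2 (.of_forall fun Δ => (hN Δ).2), fun d hqf hdV => ?_⟩
  rw [Formula.holds_ultraproduct U α hqf, Formula.holds_ultraproduct U β hqf]
  refine eventually_congr ?_
  have : ∀ᶠ Δ in (atTop : Filter (Finset Formula)), d ∈ Δ :=
    (eventually_ge_atTop {d}).mono fun Δ hΔ => hΔ (Finset.mem_singleton_self d)
  exact (this.filter_mono (Ultrafilter.of_le atTop)).mono fun Δ hΔ => hd Δ d hΔ hqf hdV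

/-! ### Embeddings -/

/-- An injective homomorphism of structures. -/
structure Struc.Embedding (M N : Struc.{u}) where
  toFun : ∀ s, M.carrier s → N.carrier s
  injective : ∀ s, Function.Injective (toFun s)
  map_rd : ∀ a i, toFun elem (M.rd a i) = N.rd (toFun array a) (toFun index i)
  map_wr : ∀ a i e,
    toFun array (M.wr a i e) = N.wr (toFun array a) (toFun index i) (toFun elem e)
  map_diff : ∀ a b, toFun index (M.diff a b) = N.diff (toFun array a) (toFun array b)

theorem Term.eval_embedding {M N : Struc.{u}} (f : M.Embedding N) (α : Assignment M)
    (β : Assignment N) {s : ArrSort} (t : Term s)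
    (h : ∀ p ∈ t.vars, β p.1 p.2 = f.toFun p.1 (α p.1 p.2)) :
    t.eval N β = f.toFun s (t.eval M α) := by
  induction t with
  | var s n => exact h (s, n) (by simp [Term.vars])
  | rd a i iha ihi =>
    simp only [Term.vars, Finset.mem_union] at h
    rw [Term.eval, Term.eval, f.map_rd, iha fun p hp => h p (by simp [hp]),
      ihi fun p hp => h p (by simp [hp])]
  | wr a i e iha ihi ihe =>
    simp only [Term.vars, Finset.mem_union] at h
    rw [Term.eval, Term.eval, f.map_wr, iha fun p hp => h p (by simp [hp]),
      ihi fun p hp => h p (by simp [hp]), ihe fun p hp => h p (by simp [hp])]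
  | diff a b iha ihb =>
    simp only [Term.vars, Finset.mem_union] at h
    rw [Term.eval, Term.eval, f.map_diff, iha fun p hp => h p (by simp [hp]),
      ihb fun p hp => h p (by simp [hp])]

theorem Formula.holds_embedding {M N : Struc.{u}} (f : M.Embedding N) (α : Assignment M)
    (β : Assignment N) {φ : Formula} (hφ : φ.QuantifierFree)
    (h : ∀ p ∈ φ.freeVars, β p.1 p.2 = f.toFun p.1 (α p.1 p.2)) :
    φ.Holds N β ↔ φ.Holds M α := by
  induction φ with
  | falsum => rfl
  | eq t t' =>
    simp only [Formula.freeVars, Finset.mem_union] at h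
    rw [Formula.Holds, Formula.Holds, Term.eval_embedding f α β t fun p hp => h p (.inl hp),
      Term.eval_embedding f α β t' fun p hp => h p (.inr hp), (f.injective _).eq_iff]
  | imp φ ψ ih₁ ih₂ =>
    simp only [Formula.freeVars, Finset.mem_union] at h
    rw [Formula.Holds, Formula.Holds, ih₁ hφ.1 fun p hp => h p (.inl hp),
      ih₂ hφ.2 fun p hp => h p (.inr hp)]
  | all => exact hφ.elim

/-! ### Amalgamation -/

/-- The set of indices at which two arrays differ. -/
def Struc.diffSet (M : Struc.{u}) (a b : M.carrier array) : Set (M.carrier index) :=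
  {i | M.rd a i ≠ M.rd b i}

/-! ### Arrays up to finitely many differences -/

section DiffSet

variable {M : Struc.{u}}

theorem Struc.diffSet_comm (a b : M.carrier array) : M.diffSet a b = M.diffSet b a := by
  ext i; exact ne_comm

theorem Struc.diffSet_finite_trans {a b c : M.carrier array} (h : (M.diffSet a b).Finite)
    (h' : (M.diffSet b c).Finite) : (M.diffSet a c).Finite := by
  refine (h.union h').subset fun i hi => ?_
  by_contra hn
  simp only [Struc.diffSet, Set.mem_union, Set.mem_ofPred_eq, not_or, not_not] at hn hi
  exact hi (hn.1.trans hn.2)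

theorem Struc.IsArrayModel.ext (hM : M.IsArrayModel) {a b : M.carrier array}
    (h : ∀ i, M.rd a i = M.rd b i) : a = b := by
  by_contra hab
  exact hM.rd_diff a b hab (h _)

theorem Struc.IsArrayModel.diffSet_wr_subset (hM : M.IsArrayModel) (a : M.carrier array)
    (i : M.carrier index) (e : M.carrier elem) : M.diffSet (M.wr a i e) a ⊆ {i} := by
  intro j hj
  by_contra hne
  exact hj (hM.rd_wr_other a i j e (Ne.symm hne))

/-- Drives the inductions on distance: copying one differing entry brings the arrays closer. -/
theorem Struc.IsArrayModel.diffSet_wr_rd (hM : M.IsArrayModel) (a b : M.carrier array)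
    (i : M.carrier index) : M.diffSet a (M.wr b i (M.rd a i)) = M.diffSet a b \ {i} := by
  ext j
  by_cases hj : i = j
  · subst hj
    simp [Struc.diffSet, hM.rd_wr_same]
  · simp [Struc.diffSet, hM.rd_wr_other _ _ _ _ hj, Ne.symm hj]

end DiffSet

/-- A partial isomorphism between two structures. -/
structure PartialIso (M N : Struc.{u}) where
  rel : ∀ s, M.carrier s → N.carrier s → Prop
  eq_iff : ∀ {s x x' y y'}, rel s x y → rel s x' y' → (x = x' ↔ y = y')
  rd : ∀ {a a' i i'}, rel array a a' → rel index i i' → rel elem (M.rd a i) (N.rd a' i')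
  wr : ∀ {a a' i i' e e'}, rel array a a' → rel index i i' → rel elem e e' →
    rel array (M.wr a i e) (N.wr a' i' e')
  diff : ∀ {a a' b b'}, rel array a a' → rel array b b' →
    rel index (M.diff a b) (N.diff a' b')

/-- The inverse of a partial isomorphism. -/
def PartialIso.symm {M N : Struc.{u}} (R : PartialIso M N) : PartialIso N M where
  rel s x y := R.rel s y x
  eq_iff h h' := (R.eq_iff h h').symm
  rd := R.rd
  wr := R.wr
  diff := R.diff

/-- Arrays in the domain of a partial isomorphism that differ only finitely often correspond to
arrays that agree outside the indices in its range. -/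
theorem PartialIso.rd_eq_of_finite {M N : Struc.{u}} (hM : M.IsArrayModel)
    (hN : N.IsArrayModel) (R : PartialIso M N) {c d : M.carrier array} {c' d' : N.carrier array}
    (hc : R.rel array c c') (hd : R.rel array d d') (hfin : (M.diffSet c d).Finite)
    {j : N.carrier index} (hj : ∀ i, ¬ R.rel index i j) : N.rd c' j = N.rd d' j := by
  induction hn : (M.diffSet c d).ncard using Nat.strong_induction_on generalizing d d' with
  | _ n ih
  by_cases hcd : c = d
  · rw [(R.eq_iff hc hd).1 hcd]
  -- The index `diff c d` is in the domain, so correcting `d` there stays in the domain. The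
  -- corresponding write in `N` misses `j`, which has no partner.
  have hi := R.diff hc hd
  have hmem : M.diff c d ∈ M.diffSet c d := hM.rd_diff c d hcd
  have hsub := hM.diffSet_wr_rd c d (M.diff c d)
  rw [ih _ (by rw [← hn, hsub]; exact Set.ncard_sdiff_singleton_lt_of_mem hmem hfin)
    (R.wr hd hi (R.rd hc hi)) (by rw [hsub]; exact hfin.sdiff) rfl]
  exact hN.rd_wr_other _ _ _ _ fun h => hj _ (h ▸ hi)

/-- Two sets can be glued along a partial bijection, with room for fresh points. -/
theorem exists_gluing {X Y : Type u} (P : Type) (R : X → Y → Prop)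
    (hR : ∀ {x x' y y'}, R x y → R x' y' → (x = x' ↔ y = y')) :
    ∃ (Z : Type u) (f : X → Z) (g : Y → Z) (p : P → Z), f.Injective ∧ g.Injective ∧ p.Injective ∧
      (∀ x y, f x = g y ↔ R x y) ∧ (∀ q x, p q ≠ f x) ∧ (∀ q y, p q ≠ g y) ∧
      ∀ z, (∃ x, f x = z) ∨ (∃ y, g y = z) ∨ ∃ q, p q = z := by
  classical
  -- Only the points of `Y` without a partner are added to `X`.
  refine ⟨(X ⊕ {y // ¬ ∃ x, R x y}) ⊕ P, fun x => .inl (.inl x),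
    fun y => if h : ∃ x, R x y then .inl (.inl h.choose) else .inl (.inr ⟨y, h⟩), .inr,
    fun _ _ h => by simpa using h, fun y y' h => ?_, Sum.inr_injective, fun x y => ?_,
    fun _ _ => by simp, fun q y => ?_, ?_⟩
  · dsimp only at h
    split_ifs at h with h₁ h₂ h₂
    · exact (hR h₁.choose_spec h₂.choose_spec).1 (by simpa using h)
    · simp at h
    · simp at h
    · simpa using h
  · dsimp only
    split_ifs with h
    · rw [Sum.inl.injEq, Sum.inl.injEq]
      exact ⟨fun e => e ▸ h.choose_spec, fun e => (hR e h.choose_spec).2 rfl⟩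
    · exact iff_of_false (by simp) fun e => h ⟨x, e⟩
  · dsimp only
    split_ifs <;> simp
  · rintro ((x | ⟨y, hy⟩) | q)
    · exact .inl ⟨x, rfl⟩
    · exact .inr (.inl ⟨y, dif_neg hy⟩)
    · exact .inr (.inr ⟨q, rfl⟩)

/-! ### Arrays as functions on the glued indices -/

section Amalgam

variable {M N : Struc.{u}} (R : PartialIso M N) {I E : Type u}
  (f : M.carrier index → I) (g : N.carrier index → I)
  (fE : M.carrier elem → E) (gE : N.carrier elem → E) (p : I) (z w : E)

/-- `F` represents the arrays of `M` as functions on the glued indices, compatibly with `N`. The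
value `z` at the point `p` marks the arrays at finite distance from a shared one. -/
structure IsRepresentation (F : M.carrier array → I → E) : Prop where
  apply_left : ∀ a i, F a (f i) = fE (M.rd a i)
  apply_right : ∀ {c c'}, R.rel array c c' → ∀ j, F c (g j) = gE (N.rd c' j)
  congr : ∀ {a b}, (M.diffSet a b).Finite → ∀ k, (∀ i, f i ≠ k) → F a k = F b k
  apply_near : ∀ {a}, (∃ c c', R.rel array c c' ∧ (M.diffSet a c).Finite) → F a p = z
  apply_far : ∀ {a}, (¬ ∃ c c', R.rel array c c' ∧ (M.diffSet a c).Finite) → F a p = w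

variable {R f g fE gE p z w}

theorem exists_representation (hM : M.IsArrayModel) (hN : N.IsArrayModel)
    (hf : f.Injective) (hg : g.Injective) (hfg : ∀ i j, f i = g j ↔ R.rel index i j)
    (hfgE : ∀ x y, fE x = gE y ↔ R.rel elem x y) (hpf : ∀ i, p ≠ f i) (hpg : ∀ j, p ≠ g j) :
    ∃ F, IsRepresentation R f g fE gE p z w F := by
  classical
  let near (a : M.carrier array) : Prop :=
    ∃ c c', R.rel array c c' ∧ (M.diffSet a c).Finite
  -- The values that shared arrays at finite distance from `a` prescribe at `k`. The final default
  -- `z` of `F` applies when there are none, and its choice is immaterial.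
  let val (a : M.carrier array) (k : I) (v : E) : Prop :=
    ∃ c c' j, R.rel array c c' ∧ (M.diffSet a c).Finite ∧ g j = k ∧ gE (N.rd c' j) = v
  let F (a : M.carrier array) (k : I) : E :=
    if h : ∃ i, f i = k then fE (M.rd a h.choose)
    else if k = p then if near a then z else w
    else if h : ∃ v, val a k v then h.choose else z
  have hleft : ∀ a i, F a (f i) = fE (M.rd a i) := fun a i => by
    have h : ∃ i', f i' = f i := ⟨i, rfl⟩
    simp only [F, dif_pos h]
    rw [hf h.choose_spec]
  have hp : ∀ a, F a p = if near a then z else w := fun a => by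
    have h : ¬ ∃ i, f i = p := fun ⟨i, hi⟩ => hpf i hi.symm
    simp only [F, dif_neg h, if_pos]
  refine ⟨F, hleft, fun {c c'} hc j => ?_, fun {a b} hab k hk => ?_,
    fun {a} h => (hp a).trans (if_pos h), fun {a} h => (hp a).trans (if_neg h)⟩
  · by_cases h : ∃ i, f i = g j
    · obtain ⟨i, hi⟩ := h
      rw [← hi, hleft, hfgE]
      exact R.rd hc ((hfg i j).1 hi)
    · have hv : ∃ v, val c (g j) v :=
        ⟨_, c, c', j, hc, by simp [Struc.diffSet], rfl, rfl⟩
      simp only [F, dif_neg h, if_neg (hpg j).symm, dif_pos hv]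
      -- The chosen value may come from another shared array `d`, but `d'` agrees with `c'` at an
      -- unmatched index.
      obtain ⟨d, d', j', hd, hfin, hj, hd'⟩ := hv.choose_spec
      rw [← hd', hg hj]
      exact congrArg gE (R.rd_eq_of_finite hM hN hc hd hfin fun i hi =>
        h ⟨i, (hfg i j).2 hi⟩).symm
  -- Off the range of `f`, the function depends only on the class of the array modulo finite
  -- differences.
  · have hiff : ∀ c, (M.diffSet a c).Finite ↔ (M.diffSet b c).Finite := fun c =>
      ⟨Struc.diffSet_finite_trans (Struc.diffSet_comm a b ▸ hab), Struc.diffSet_finite_trans hab⟩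
    have hnear : near a = near b := by simp only [near, hiff]
    have hval : val a k = val b k := by
      funext v
      simp only [val, hiff]
    have h : ¬ ∃ i, f i = k := fun ⟨i, hi⟩ => hk i hi
    simp only [F, dif_neg h, hnear, hval]

namespace IsRepresentation

variable {F : M.carrier array → I → E}

theorem injective (hF : IsRepresentation R f g fE gE p z w F) (hM : M.IsArrayModel)
    (hfE : fE.Injective) : F.Injective := fun a b h =>
  hM.ext fun i => hfE (by rw [← hF.apply_left, ← hF.apply_left, h])

/-- Outside the range of `f` a write changes nothing, because it is a finite modification and
`congr` applies. -/
theorem map_wr [DecidableEq I] (hF : IsRepresentation R f g fE gE p z w F)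
    (hM : M.IsArrayModel) (hf : f.Injective) (a : M.carrier array) (i : M.carrier index)
    (e : M.carrier elem) : F (M.wr a i e) = Function.update (F a) (f i) (fE e) := by
  funext k
  by_cases hk : ∃ j, f j = k
  · obtain ⟨j, rfl⟩ := hk
    by_cases hij : i = j
    · subst hij
      rw [Function.update_self, hF.apply_left, hM.rd_wr_same]
    · rw [Function.update_of_ne (hf.ne (Ne.symm hij)), hF.apply_left, hF.apply_left,
        hM.rd_wr_other _ _ _ _ hij]
  · rw [Function.update_of_ne fun h => hk ⟨i, h.symm⟩]
    exact hF.congr ((Set.finite_singleton i).subset (hM.diffSet_wr_subset a i e)) k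
      fun j hj => hk ⟨j, hj⟩

/-- All differences lie in the range of `f` when there are finitely many in `M`. Finite distance can
thus be read off the functions and transferred between `M` and `N`. -/
theorem finite_iff (hF : IsRepresentation R f g fE gE p z w F) (hf : f.Injective)
    (hfE : fE.Injective) {a b : M.carrier array} :
    (M.diffSet a b).Finite ↔ {k | F a k ≠ F b k}.Finite := by
  constructor
  · intro h
    refine (h.image f).subset fun k hk => ?_
    by_cases hk' : ∃ i, f i = k
    · obtain ⟨i, rfl⟩ := hk'
      refine ⟨i, fun hi => hk ?_, rfl⟩
      rw [hF.apply_left, hF.apply_left, hi]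
    · exact (hk (hF.congr h k fun i hi => hk' ⟨i, hi⟩)).elim
  · intro h
    refine (h.preimage hf.injOn).subset fun i hi hk => hi ?_
    rw [hF.apply_left, hF.apply_left] at hk
    exact hfE hk

variable {w' : E} {G : N.carrier array → I → E}

theorem eq_of_rel (hF : IsRepresentation R f g fE gE p z w F)
    (hG : IsRepresentation R.symm g f gE fE p z w' G)
    (hcov : ∀ k, (∃ i, f i = k) ∨ (∃ j, g j = k) ∨ p = k) {a : M.carrier array}
    {b : N.carrier array} (h : R.rel array a b) : F a = G b := by
  funext k
  rcases hcov k with ⟨i, rfl⟩ | ⟨j, rfl⟩ | rfl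
  · rw [hF.apply_left, hG.apply_right (c := b) (c' := a) h]
  · rw [hG.apply_left, hF.apply_right h]
  · rw [hF.apply_near ⟨a, b, h, by simp [Struc.diffSet]⟩,
      hG.apply_near ⟨b, a, h, by simp [Struc.diffSet]⟩]

/-- The two representations have only shared arrays in common. -/
theorem rel_of_eq (hF : IsRepresentation R f g fE gE p z w F)
    (hG : IsRepresentation R.symm g f gE fE p z w' G) (hM : M.IsArrayModel)
    (hN : N.IsArrayModel) (hf : f.Injective) (hg : g.Injective) (hfE : fE.Injective)
    (hgE : gE.Injective) (hfg : ∀ i j, f i = g j ↔ R.rel index i j)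
    (hfgE : ∀ x y, fE x = gE y ↔ R.rel elem x y)
    (hcov : ∀ k, (∃ i, f i = k) ∨ (∃ j, g j = k) ∨ p = k) (hw : w ≠ w') {a : M.carrier array}
    {b : N.carrier array} (h : F a = G b) : R.rel array a b := by
  have hiff : ∀ {c d}, R.rel array c d →
      ((M.diffSet a c).Finite ↔ (N.diffSet b d).Finite) := fun {c d} hcd => by
    rw [hF.finite_iff hf hfE, hG.finite_iff hg hgE, h, hF.eq_of_rel hG hcov hcd]
  -- Otherwise both `a` and `b` are far from every shared array, and their values at `p` are the
  -- distinct markers `w` and `w'`.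
  have hnear : ∃ c d, R.rel array c d ∧ (M.diffSet a c).Finite := by
    by_contra hn
    refine hw ?_
    rw [← hF.apply_far hn, h]
    exact hG.apply_far fun ⟨d, c, hdc, hfin⟩ => hn ⟨c, d, hdc, (hiff hdc).2 hfin⟩
  obtain ⟨c, d, hcd, hfin⟩ := hnear
  induction hn : (M.diffSet a c).ncard using Nat.strong_induction_on generalizing c d with
  | _ n ih
  by_cases hac : a = c
  · subst hac
    rwa [hG.injective hN hgE (h.symm.trans (hF.eq_of_rel hG hcov hcd))]
  have hmem : M.diff a c ∈ M.diffSet a c := hM.rd_diff a c hac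
  generalize M.diff a c = i at hmem
  -- As `a` is not known to be shared, `R.diff` is unavailable. Instead, at an index outside the
  -- range of `g`, `congr` for `G` would make `b` and `d` agree, hence `a` and `c` too.
  obtain ⟨j, hj⟩ : ∃ j, g j = f i := by
    by_contra hi
    refine hmem (hfE ?_)
    rw [← hF.apply_left, ← hF.apply_left, h, hF.eq_of_rel hG hcov hcd]
    exact hG.congr ((hiff hcd).1 hfin) _ fun j hj => hi ⟨j, hj⟩
  have hval : R.rel elem (M.rd a i) (N.rd b j) := by
    rw [← hfgE, ← hF.apply_left, ← hG.apply_left, h, hj]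
  have hsub := hM.diffSet_wr_rd a c i
  -- Writing the entry of `a` at `i` into `c` gives a shared array closer to `a`.
  exact ih _ (by rw [← hn, hsub]; exact Set.ncard_sdiff_singleton_lt_of_mem hmem hfin) _ _
    (R.wr hcd ((hfg i j).1 hj.symm) hval) (by rw [hsub]; exact hfin.sdiff) rfl

end IsRepresentation

end Amalgam

/-- The structure whose arrays are all functions from `I` to `E`. -/
def functionStruc (I E : Type u) [DecidableEq I] [Nonempty I] [Nonempty E]
    (diff : (I → E) → (I → E) → I) : Struc.{u} where
  carrier
    | array => I → E
    | index => I
    | elem => E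
  nonempty
    | array => inferInstanceAs (Nonempty (I → E))
    | index => ‹Nonempty I›
    | elem => ‹Nonempty E›
  rd a i := a i
  wr a i e := Function.update a i e
  diff := diff

/-- Models of the theory of arrays with `diff` amalgamate over a partial isomorphism. -/
theorem exists_amalgam {M N : Struc.{u}} (hM : M.IsArrayModel) (hN : N.IsArrayModel)
    (R : PartialIso M N) :
    ∃ (K : Struc.{u}) (f : M.Embedding K) (g : N.Embedding K), K.IsArrayModel ∧
      ∀ s x y, R.rel s x y → f.toFun s x = g.toFun s y := by
  classical
  obtain ⟨I, f, g, q, hf, hg, -, hfg, hqf, hqg, hcov⟩ :=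
    exists_gluing Unit (R.rel index) R.eq_iff
  -- Three markers: one common to all arrays near a shared one, and one each for the far arrays of
  -- `M` and of `N`.
  obtain ⟨E, fE, gE, r, hfE, hgE, hr, hfgE, -, -, -⟩ :=
    exists_gluing (Fin 3) (R.rel elem) R.eq_iff
  obtain ⟨F, hF⟩ := exists_representation (z := r 0) (w := r 1) hM hN hf hg hfg hfgE
    (hqf ()) (hqg ())
  obtain ⟨G, hG⟩ := exists_representation (R := R.symm) (z := r 0) (w := r 2) hN hM hg hf
    (fun i j => eq_comm.trans (hfg j i)) (fun x y => eq_comm.trans (hfgE y x)) (hqg ()) (hqf ())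
  have hcov' : ∀ k, (∃ i, f i = k) ∨ (∃ j, g j = k) ∨ q () = k := fun k => by
    simpa only [Unique.exists_iff] using hcov k
  have hFinj := hF.injective hM hfE
  have hGinj := hG.injective hN hgE
  have hrel : ∀ {a b}, F a = G b → R.rel array a b := fun h =>
    hF.rel_of_eq hG hM hN hf hg hfE hgE hfg hfgE hcov' (hr.ne (by decide)) h
  -- A pair in both images consists of shared arrays, where `R.diff` reconciles the two
  -- prescriptions. A pair in neither image gets any index at which its members differ.
  have hdiff : ∀ x y : I → E, ∃ k, (∀ a b, F a = x → F b = y → k = f (M.diff a b)) ∧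
      (∀ a b, G a = x → G b = y → k = g (N.diff a b)) ∧ (x ≠ y → x k ≠ y k) := by
    intro x y
    by_cases h₁ : ∃ a b, F a = x ∧ F b = y
    · obtain ⟨a, b, rfl, rfl⟩ := h₁
      refine ⟨f (M.diff a b), fun a' b' ha hb => by rw [hFinj ha, hFinj hb],
        fun a' b' ha hb => (hfg _ _).2 (R.diff (hrel ha.symm) (hrel hb.symm)), fun hab h => ?_⟩
      rw [hF.apply_left, hF.apply_left] at h
      exact hM.rd_diff a b (fun e => hab (congrArg F e)) (hfE h)
    by_cases h₂ : ∃ a b, G a = x ∧ G b = y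
    · obtain ⟨a, b, rfl, rfl⟩ := h₂
      refine ⟨g (N.diff a b), fun a' b' ha hb => (h₁ ⟨a', b', ha, hb⟩).elim,
        fun a' b' ha hb => by rw [hGinj ha, hGinj hb], fun hab h => ?_⟩
      rw [hG.apply_left, hG.apply_left] at h
      exact hN.rd_diff a b (fun e => hab (congrArg G e)) (hgE h)
    obtain ⟨k, hk⟩ : ∃ k, x ≠ y → x k ≠ y k := by
      by_cases hxy : x = y
      · exact ⟨q (), fun h => (h hxy).elim⟩
      · obtain ⟨k, hk⟩ := Function.ne_iff.1 hxy
        exact ⟨k, fun _ => hk⟩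
    exact ⟨k, fun a b ha hb => (h₁ ⟨a, b, ha, hb⟩).elim,
      fun a b ha hb => (h₂ ⟨a, b, ha, hb⟩).elim, hk⟩
  choose δ hδF hδG hδ using hdiff
  have : Nonempty I := ⟨q ()⟩
  have : Nonempty E := ⟨r 0⟩
  refine ⟨functionStruc I E δ,
    ⟨fun | array => F | index => f | elem => fE, ?_, fun a i => (hF.apply_left a i).symm,
      hF.map_wr hM hf, fun a b => (hδF _ _ a b rfl rfl).symm⟩,
    ⟨fun | array => G | index => g | elem => gE, ?_, fun a i => (hG.apply_left a i).symm,
      hG.map_wr hN hg, fun a b => (hδG _ _ a b rfl rfl).symm⟩,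
    ⟨fun y i e => @Function.update_self I (fun _ => E) _ i e y,
      fun y i j e h => @Function.update_of_ne I (fun _ => E) _ j i (Ne.symm h) e y,
      fun x y h => hδ x y h⟩, ?_⟩
  · rintro (_ | _ | _)
    exacts [hFinj, hf, hfE]
  · rintro (_ | _ | _)
    exacts [hGinj, hg, hgE]
  · rintro (_ | _ | _) x y h
    exacts [hF.eq_of_rel hG hcov' h, (hfg x y).2 h, (hfgE x y).2 h]

/-- The partial isomorphism between the substructures generated by the values of the variables
in `V`. -/
def PartialIso.ofAgreeing {M N : Struc.{u}} {α : Assignment M} {β : Assignment N}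
    {V : Finset (ArrSort × ℕ)}
    (h : ∀ d : Formula, d.QuantifierFree → d.freeVars ⊆ V → (d.Holds M α ↔ d.Holds N β)) :
    PartialIso M N where
  rel s x y := ∃ t : Term s, t.vars ⊆ V ∧ t.eval M α = x ∧ t.eval N β = y
  eq_iff := by
    rintro s _ _ _ _ ⟨t, ht, rfl, rfl⟩ ⟨t', ht', rfl, rfl⟩
    exact h (.eq t t') trivial (Finset.union_subset ht ht')
  rd := by
    rintro _ _ _ _ ⟨a, ha, rfl, rfl⟩ ⟨i, hi, rfl, rfl⟩
    exact ⟨.rd a i, Finset.union_subset ha hi, rfl, rfl⟩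
  wr := by
    rintro _ _ _ _ _ _ ⟨a, ha, rfl, rfl⟩ ⟨i, hi, rfl, rfl⟩ ⟨e, he, rfl, rfl⟩
    exact ⟨.wr a i e, Finset.union_subset (Finset.union_subset ha hi) he, rfl, rfl⟩
  diff := by
    rintro _ _ _ _ ⟨a, ha, rfl, rfl⟩ ⟨b, hb, rfl, rfl⟩
    exact ⟨.diff a b, Finset.union_subset ha hb, rfl, rfl⟩

end ArraysDiff

open ArraysDiff in
theorem theorem3p3 : ArraysDiff.AdmitsQuantifierFreeInterpolation.{u} ArraysDiff.AXdiff := by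
  intro φ ψ hφ hψ hunsat
  by_cases h : ∃ θ : Formula, θ.QuantifierFree ∧ θ.freeVars ⊆ ψ.freeVars ∩ φ.freeVars ∧
      (∀ (M : Struc.{u}) (α : Assignment M), M.IsArrayModel ∧ ψ.Holds M α → θ.Holds M α) ∧
      ∀ (M : Struc.{u}) (α : Assignment M), M.IsArrayModel ∧ φ.Holds M α → ¬ θ.Holds M α
  · obtain ⟨θ, hθ, hV, h₁, h₂⟩ := h
    refine ⟨θ, hθ, ?_, ?_, hV⟩
    · rintro ⟨M, hM, α, hα⟩
      exact hα fun hψM => h₁ M α ⟨(isModel_AXdiff_iff M).1 hM, hψM⟩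
    · rintro ⟨M, hM, α, hα⟩
      rw [Formula.holds_and] at hα
      exact h₂ M α ⟨(isModel_AXdiff_iff M).1 hM, hα.2⟩ hα.1
  · obtain ⟨M, α, N, β, hM, hN, hψM, hφN, hagree⟩ := exists_models_agreeing hψ hφ h
    obtain ⟨K, f, g, hK, hfg⟩ := exists_amalgam hM hN (PartialIso.ofAgreeing hagree)
    let γ : Assignment K := fun s n =>
      if (s, n) ∈ ψ.freeVars then f.toFun s (α s n) else g.toFun s (β s n)
    refine (hunsat ⟨K, (isModel_AXdiff_iff K).2 hK, γ, Formula.holds_and.2 ⟨?_, ?_⟩⟩).elim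
    · exact (Formula.holds_embedding f α γ hψ fun p hp => if_pos hp).2 hψM
    · refine (Formula.holds_embedding g β γ hφ fun p hp => ?_).2 hφN
      by_cases hpψ : p ∈ ψ.freeVars
      -- A shared variable is itself a term over the shared variables, so the embeddings identify
      -- its two values.
      · refine (if_pos hpψ).trans (hfg _ _ _ ⟨.var p.1 p.2, ?_, rfl, rfl⟩)
        simpa [Term.vars] using ⟨hpψ, hp⟩
      · exact if_neg hpψ
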